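/- Conventions. All hypergraphs are finite: for an integer $r\ge 2$, an $r$-uniform hypergraph $H$ consists of a finite vertex set $V(H)$ and a set $E(H)$ of $r$-subsets of $V(H)$, called edges. The chromatic number $\chi(H)$ is the least $k$ for which there is a map $V(H)\to\{1,\dots,k\}$ that is not constant on any edge; the minimum degree $\delta(H)$ is the minimum over all vertices $v$ of the number of edges containing $v$. The chromatic threshold of a family $\mathcal F$ of $r$-uniform hypergraphs is the infimum of all $c\ge 0$ such that the members $G$ of $\mathcal F$ with $\delta(G)\ge c\binom{|V(G)|}{r-1}$ have bounded chromatic number. A hypergraph $G$ is $H$-free if there is no injection $V(H)\to V(G)$ that maps every edge of $H$ to an edge of $G$. For $S\subseteq V(H)$, $H[S]$ is the hypergraph on $S$ whose edges are the edges of $H$ contained in $S$, and $H|_S$ is the hypergraph on $S$ with edge set $\{A\cap S: A\in E(H)\}$. The set $S$ is strongly independent if no edge of $H$ contains two vertices of $S$. Components are connected components; a vertex that lies in no edge with another vertex is a component by itself. Parts of partitions may be empty. A near $r$-partition of $H$ is a partition $V(H)=V_1\cup\dots\cup V_r$ such that every edge of $H$ either has exactly one vertex in each $V_i$ or is contained in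 $V_1$, and such that the edges of $H[V_1]$ are pairwise disjoint. For disjoint $X,Y\subseteq V(H)$, the set $X$ is partite-extendible to $Y$ if there is a partition of $X$ into strongly independent sets $X_1,\dots,X_r$ such that for every component $C$ of $H|_Y$ there are no $j\ne \ell$, $x_1\in X_j$, $x_2\in X_\ell$ and (not necessarily distinct) edges $E_1,E_2$ of $C$ with $E_1\cup\{x_1\}\in E(H)$ and $E_2\cup\{x_2\}\in E(H)$. Theorem. Let $r\ge 2$ and let $H$ be an $r$-uniform hypergraph with a near $r$-partition $V_1,\dots,V_r$. Suppose that the vertex set of every component of $H[V_1]$ (single vertices included) is partite-extendible to $V_2\cup\dots\cup V_r$. Then the chromatic threshold of the family of $H$-free $r$-uniform hypergraphs is $0$. -/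

import Mathlib

universe u v

open scoped Hypergraph

namespace Hypergraph

/-- An `r`-uniform hypergraph: the vertex set is finite and every edge is an `r`-subset of it. -/
structure IsUniform {α : Type u} (H : Hypergraph α) (r : ℕ) : Prop where
  finite_vertexSet : V(H).Finite
  ncard_eq : ∀ e ∈ E(H), e.ncard = r

/-- `H.Colorable k`: there is a map `V(H) → [k]` that is not constant on any edge, in the sense
that every edge contains two vertices of different colours. -/
def Colorable {α : Type u} (H : Hypergraph α) (k : ℕ) : Prop :=
  ∃ c : V(H) → Fin k, ∀ e ∈ E(H), ∃ x y : V(H), (x : α) ∈ e ∧ (y : α) ∈ e ∧ c x ≠ c y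

/-- The least number of colours in a proper colouring (`⊤` if there is none, which happens only
when some edge has at most one vertex). -/
noncomputable def chromaticNumber {α : Type u} (H : Hypergraph α) : ℕ∞ :=
  ⨅ k ∈ {k : ℕ | H.Colorable k}, (k : ℕ∞)

/-- The number of edges containing `x`. -/
noncomputable def degree {α : Type u} (H : Hypergraph α) (x : α) : ℕ :=
  {e | e ∈ E(H) ∧ x ∈ e}.ncard

/-- The minimum of the degrees of the vertices (`0` if there are no vertices). -/
noncomputable def minDegree {α : Type u} (H : Hypergraph α) : ℕ :=
  sInf (H.degree '' V(H))

/-- `F.IsSubhypergraph G`: some injection `V(F) → V(G)` maps every edge of `F` to an edge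
of `G`, that is, `G` contains a (not necessarily induced) copy of `F`. -/
def IsSubhypergraph {α : Type u} {β : Type v} (F : Hypergraph α) (G : Hypergraph β) : Prop :=
  ∃ f : V(F) → β, Function.Injective f ∧ (∀ x, f x ∈ V(G)) ∧
    ∀ e ∈ E(F), f '' {x | (x : α) ∈ e} ∈ E(G)

/-- A family of hypergraphs, on arbitrary vertex types. -/
abbrev Family : Type (v + 1) := (β : Type v) → Set (Hypergraph β)

/-- The family of `r`-uniform hypergraphs that do not contain `H`. -/
def freeFamily {α : Type u} (r : ℕ) (H : Hypergraph α) : Family.{v} :=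
  fun _ => {G | G.IsUniform r ∧ ¬ H.IsSubhypergraph G}

/-- The reals `c ≥ 0` such that the members `G` of `𝓕` with minimum degree at least
`c * (|V(G)| choose (r - 1))` have bounded chromatic number. -/
def thresholdSet (r : ℕ) (𝓕 : Family.{v}) : Set ℝ :=
  {c | 0 ≤ c ∧ ∃ k : ℕ, ∀ (β : Type v) (G : Hypergraph β), G ∈ 𝓕 β →
    c * (V(G).ncard.choose (r - 1) : ℝ) ≤ (G.minDegree : ℝ) → G.chromaticNumber ≤ (k : ℕ∞)}

/-- The chromatic threshold of a family of `r`-uniform hypergraphs. -/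
noncomputable def chromaticThreshold (r : ℕ) (𝓕 : Family.{v}) : ℝ :=
  sInf (thresholdSet r 𝓕)

/-- The hypergraph `H[S]` induced by `S`: its edges are the edges of `H` contained in `S`. -/
def induce {α : Type u} (H : Hypergraph α) (S : Set α) : Hypergraph α where
  vertexSet := V(H) ∩ S
  edgeSet := {e | e ∈ E(H) ∧ e ⊆ S}
  subset_vertexSet_of_mem_edgeSet' := fun _ he =>
    Set.subset_inter (H.subset_vertexSet_of_mem_edgeSet' he.1) he.2

/-- The hypergraph `H|_Y` on `Y`, with edges `A ∩ Y` for `A ∈ E(H)`. -/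
def restrict {α : Type u} (H : Hypergraph α) (Y : Set α) : Hypergraph α where
  vertexSet := V(H) ∩ Y
  edgeSet := {e | ∃ A ∈ E(H), e = A ∩ Y}
  subset_vertexSet_of_mem_edgeSet' := by
    rintro _ ⟨A, hA, rfl⟩
    exact Set.inter_subset_inter_left Y (H.subset_vertexSet_of_mem_edgeSet' hA)

/-- `C` is a (connected) component of `H`: the subhypergraph induced by the set of all vertices
that can be reached from some vertex `x` of `H` through edges. It is a single vertex if `x` lies
in no edge with another vertex. -/
def IsComponent {α : Type u} (H C : Hypergraph α) : Prop :=
  ∃ x ∈ V(H), C = H.induce {y | Relation.ReflTransGen H.Adj x y}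

/-- No edge of `H` contains two vertices of `S`. -/
def IsStronglyIndependent {α : Type u} (H : Hypergraph α) (S : Set α) : Prop :=
  ∀ e ∈ E(H), (e ∩ S).Subsingleton

/-- The sets `P i` (some of which may be empty) partition `S`. -/
structure IsPartition {α : Type u} {r : ℕ} (P : Fin r → Set α) (S : Set α) : Prop where
  iUnion_eq : ⋃ i, P i = S
  disjoint : ∀ i j, i ≠ j → Disjoint (P i) (P j)

/-- `X` is partite-extendible to `Y`: there is a partition of `X` into `r` strongly independent
sets such that each component `C` of `H|_Y` extends to at most one of them. The edges `e₁`, `e₂`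
of `C` may coincide. -/
def PartiteExtendible {α : Type u} (r : ℕ) (H : Hypergraph α) (X Y : Set α) : Prop :=
  ∃ P : Fin r → Set α, IsPartition P X ∧ (∀ i, H.IsStronglyIndependent (P i)) ∧
    ∀ C : Hypergraph α, (H.restrict Y).IsComponent C →
      ¬ ∃ j l : Fin r, j ≠ l ∧ ∃ x₁ ∈ P j, ∃ x₂ ∈ P l, ∃ e₁ ∈ E(C), ∃ e₂ ∈ E(C),
        e₁ ∪ {x₁} ∈ E(H) ∧ e₂ ∪ {x₂} ∈ E(H)

/-- The edges are pairwise disjoint. -/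
def IsPartialMatching {α : Type u} (H : Hypergraph α) : Prop :=
  ∀ e₁ ∈ E(H), ∀ e₂ ∈ E(H), e₁ ≠ e₂ → Disjoint e₁ e₂

/-- `P` is a near `r`-partition of `H`, where `P 0` is the part that may contain edges: every edge
has exactly one vertex in each part or is contained in `P 0`, and `H[P 0]` is a partial
matching. -/
structure IsNearPartition {α : Type u} {r : ℕ} [NeZero r] (H : Hypergraph α)
    (P : Fin r → Set α) : Prop where
  isPartition : IsPartition P V(H)
  crossing_or_subset : ∀ e ∈ E(H), (∀ i, (e ∩ P i).ncard = 1) ∨ e ⊆ P 0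
  isPartialMatching : (H.induce (P 0)).IsPartialMatching

/-- A hypergraph is near `r`-partite if it has a near `r`-partition. -/
def IsNearPartite {α : Type u} (r : ℕ) [NeZero r] (H : Hypergraph α) : Prop :=
  ∃ P : Fin r → Set α, H.IsNearPartition P

/-! The infimum in the definition of the chromatic threshold is a genuine one. -/

theorem IsUniform.minDegree_le {β : Type v} {G : Hypergraph β} {r : ℕ} (hG : G.IsUniform r) :
    G.minDegree ≤ V(G).ncard.choose (r - 1) := by
  classical
  rcases V(G).eq_empty_or_nonempty with h | ⟨x, hx⟩
  · simp [minDegree, h]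
  have hfin := hG.finite_vertexSet
  have hle : G.minDegree ≤ G.degree x := Nat.sInf_le (Set.mem_image_of_mem _ hx)
  refine hle.trans ?_
  unfold degree
  have hc : V(G).ncard = hfin.toFinset.card := Set.ncard_eq_toFinset_card _ hfin
  rw [hc, ← Finset.card_powersetCard, ← Set.ncard_coe_finset,
    ← Set.ncard_image_of_injective _ (Finset.coe_injective (α := β))]
  refine Set.ncard_le_ncard_of_injOn (fun e => e \ {x}) ?_ ?_ ?_
  · rintro e ⟨he, hxe⟩
    have hes := G.subset_vertexSet_of_mem_edgeSet' he
    have hef : (e \ {x}).Finite := (hfin.subset hes).subset Set.sdiff_subset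
    refine ⟨hef.toFinset, ?_, by simp⟩
    simp only [Finset.mem_coe, Finset.mem_powersetCard]
    refine ⟨?_, ?_⟩
    · intro y hy
      exact hfin.mem_toFinset.2 (hes (hef.mem_toFinset.1 hy).1)
    · rw [← Set.ncard_eq_toFinset_card _ hef, Set.ncard_sdiff_singleton_of_mem hxe,
        hG.ncard_eq e he]
  · rintro e ⟨_, hxe⟩ e' ⟨_, hxe'⟩ h
    simp only at h
    rw [← Set.insert_sdiff_self_of_mem hxe, ← Set.insert_sdiff_self_of_mem hxe', h]
  · exact (Finset.finite_toSet _).image _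

theorem thresholdSet_nonempty {r : ℕ} (hr : 1 ≤ r) {𝓕 : Family.{v}}
    (h𝓕 : ∀ (β : Type v), ∀ G ∈ 𝓕 β, G.IsUniform r) : (thresholdSet r 𝓕).Nonempty := by
  refine ⟨2, by norm_num, 1, fun β G hGF hdeg => ?_⟩
  have hG := h𝓕 β G hGF
  have h1 : G.minDegree ≤ V(G).ncard.choose (r - 1) := hG.minDegree_le
  have h1' : (G.minDegree : ℝ) ≤ (V(G).ncard.choose (r - 1) : ℝ) := by exact_mod_cast h1
  have h2 : (V(G).ncard.choose (r - 1) : ℝ) ≤ 0 := by linarith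
  have h3 : V(G).ncard.choose (r - 1) = 0 := by
    exact_mod_cast le_antisymm h2 (Nat.cast_nonneg _)
  rw [Nat.choose_eq_zero_iff] at h3
  have h4 : G.Colorable 1 := by
    refine ⟨fun _ => 0, fun e he => ?_⟩
    have := Set.ncard_le_ncard (G.subset_vertexSet_of_mem_edgeSet' he) hG.finite_vertexSet
    rw [hG.ncard_eq e he] at this
    omega
  exact iInf₂_le (1 : ℕ) h4

theorem isGLB_chromaticThreshold {r : ℕ} (hr : 1 ≤ r) {𝓕 : Family.{v}}
    (h𝓕 : ∀ (β : Type v), ∀ G ∈ 𝓕 β, G.IsUniform r) :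
    IsGLB (thresholdSet r 𝓕) (chromaticThreshold r 𝓕) :=
  isGLB_csInf (thresholdSet_nonempty hr h𝓕) ⟨0, fun _ hc => hc.1⟩

end Hypergraph

/-! Put `k = r - 1` and let `G` have minimum degree at least `ε * (n choose k)` and huge chromatic
number. The ordered link of every vertex is then a dense set of `k`-tuples.

The core is `exists_edges_shattered`: `G` has `m` disjoint edges such that, for every choice `φ` of
one vertex from each, the chosen vertices have a dense common link. The edges are found one at a
time, keeping a set `U` of large chromatic number whose vertices have links meeting each common link
so far in a dense set. If no next edge worked, then for every edge in `U` most of the chromatic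
number would sit on vertices badly spread with respect to one fixed vertex of the edge. Iterating
this inside ever smaller sets gives many vertices whose links, cut down to one common link, are
dense but pairwise have small intersection, which is impossible.

By Erdős's theorem on complete multipartite hypergraphs (`exists_complete_partite_family`), each of
the `r ^ m` common links contains a complete `k`-partite piece, and these pieces can be kept
disjoint from each other and from the `m` edges.

Now `H` embeds. The components of `H[V_1]` go into different edges among the `m`, the partitions
given by extendibility telling which vertex of the edge to use. Extendibility says that a component
of `H|_Y`, with `Y` the union of the other parts, sees at most one label in each component of
`H[V_1]`. So it determines a choice `φ` and goes into the piece of `φ` (`MatchingEncoding`). -/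

/-! ### Dense families of sets and complete multipartite pieces -/

open Finset in
/-- Among many dense subsets of a finite type there are `t` with a dense intersection. -/
theorem exists_card_eq_le_card_inter (t : ℕ) {γ : ℝ} (hγ : 0 < γ) :
    ∃ N : ℕ, ∃ γ' : ℝ, 0 < γ' ∧ ∀ {ι : Type u} {Y : Type v} [Fintype Y] [DecidableEq Y]
      (I : Finset ι) (B : ι → Finset Y), N ≤ I.card →
      (∀ i ∈ I, γ * Fintype.card Y ≤ (B i).card) →
      ∃ T ⊆ I, T.card = t ∧ ∃ S : Finset Y, γ' * Fintype.card Y ≤ S.card ∧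
        ∀ y ∈ S, ∀ i ∈ T, y ∈ B i := by
  classical
  -- On average a point lies in at least `γ * N ≥ 2 * t` of `N` sets, so a proportion `γ / 2` of the
  -- points lies in at least `t` of them. Pigeonhole over the `N.choose t` subfamilies gives `γ'`.
  set N : ℕ := ⌈2 * t / γ⌉₊ + t + 1 with hN
  have hNpos : (0 : ℝ) < N := by positivity
  have hNt : 2 * (t : ℝ) ≤ γ * N := by
    have h1 : 2 * t / γ ≤ ⌈2 * t / γ⌉₊ := Nat.le_ceil _
    have h2' : ⌈2 * t / γ⌉₊ ≤ N := by omega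
    have h2 : (⌈2 * t / γ⌉₊ : ℝ) ≤ N := Nat.cast_le.2 h2'
    have h3 := h1.trans h2
    rw [div_le_iff₀ hγ] at h3
    linarith
  have hchoose : (0 : ℝ) < N.choose t := by exact_mod_cast Nat.choose_pos (by omega)
  refine ⟨N, γ / 2 / N.choose t, by positivity, ?_⟩
  intro ι Y _ _ I₀ B hI₀ hB₀
  obtain ⟨I, hII, hI⟩ := exists_subset_card_eq hI₀
  have hB : ∀ i ∈ I, γ * Fintype.card Y ≤ (B i).card := fun i hi => hB₀ i (hII hi)
  set d : Y → ℕ := fun y => (I.filter fun i => y ∈ B i).card with hd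
  set Y' : Finset Y := univ.filter fun y => t ≤ d y with hY'
  have hdouble : ∑ i ∈ I, (B i).card = ∑ y, d y := by
    simp only [hd, card_eq_sum_ones, sum_filter]
    rw [sum_comm]
    refine sum_congr rfl fun i _ => ?_
    rw [← sum_filter]
    congr 1
    ext y
    simp
  have hlow : γ * Fintype.card Y * N ≤ ∑ y, (d y : ℝ) := by
    have : ∑ i ∈ I, γ * Fintype.card Y ≤ ∑ i ∈ I, ((B i).card : ℝ) := sum_le_sum hB
    rw [sum_const, hI, nsmul_eq_mul] at this
    have h : (∑ i ∈ I, ((B i).card : ℝ)) = ∑ y, (d y : ℝ) := by exact_mod_cast hdouble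
    linarith
  have hup : ∑ y, (d y : ℝ) ≤ N * Y'.card + t * Fintype.card Y := by
    have h : ∀ y ∈ (univ : Finset Y), (d y : ℝ) ≤ (if t ≤ d y then (N : ℝ) else 0) + t := by
      intro y _
      split_ifs with h
      · have : d y ≤ N := (card_filter_le _ _).trans hI.le
        have : (d y : ℝ) ≤ N := by exact_mod_cast this
        have : (0 : ℝ) ≤ t := by positivity
        linarith
      · have : d y ≤ t := by omega
        have : (d y : ℝ) ≤ t := by exact_mod_cast this
        linarith
    refine (sum_le_sum h).trans ?_
    rw [sum_add_distrib, ← sum_filter, sum_const, sum_const, card_univ, nsmul_eq_mul,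
      nsmul_eq_mul, mul_comm (N : ℝ), mul_comm (t : ℝ)]
  have hgood : γ / 2 * Fintype.card Y ≤ Y'.card := by
    have h1 : 2 * (t : ℝ) * Fintype.card Y ≤ γ * N * Fintype.card Y := by gcongr
    have : (γ / 2 * Fintype.card Y) * N ≤ Y'.card * N := by nlinarith
    exact le_of_mul_le_mul_right this hNpos
  have hcover : Y' ⊆ (powersetCard t I).biUnion fun T => univ.filter fun y => ∀ i ∈ T, y ∈ B i := by
    intro y hy
    obtain ⟨T, hT, hTc⟩ := exists_subset_card_eq (mem_filter.1 hy).2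
    refine mem_biUnion.2 ⟨T, mem_powersetCard.2 ⟨hT.trans (filter_subset _ _), hTc⟩, ?_⟩
    exact mem_filter.2 ⟨mem_univ _, fun i hi => (mem_filter.1 (hT hi)).2⟩
  have hsum : ∑ T ∈ powersetCard t I, γ / 2 / N.choose t * Fintype.card Y ≤
      ∑ T ∈ powersetCard t I, ((univ.filter fun y => ∀ i ∈ T, y ∈ B i).card : ℝ) := by
    rw [sum_const, card_powersetCard, hI, nsmul_eq_mul]
    have h1 : (Y'.card : ℝ) ≤
        ∑ T ∈ powersetCard t I, ((univ.filter fun y => ∀ i ∈ T, y ∈ B i).card : ℝ) := by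
      exact_mod_cast (card_le_card hcover).trans card_biUnion_le
    refine le_trans (le_of_eq ?_) (hgood.trans h1)
    field_simp
  obtain ⟨T, hT, hle⟩ := exists_le_of_sum_le
    (powersetCard_nonempty.2 (by omega)) hsum
  exact ⟨T, (mem_powersetCard.1 hT).1.trans hII, (mem_powersetCard.1 hT).2, _, hle,
    fun y hy => (mem_filter.1 hy).2⟩

open Finset in
/-- A dense `k`-ary relation contains a complete `k`-partite one that avoids a given small set. -/
theorem exists_complete_partite (t k : ℕ) : ∀ {γ : ℝ} (_ : 0 < γ) (z : ℕ),
    ∃ n₀ : ℕ, ∀ {V : Type v} [Fintype V] [DecidableEq V], n₀ ≤ Fintype.card V →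
      ∀ R : Finset (Fin k → V), γ * (Fintype.card V : ℝ) ^ k ≤ R.card →
      ∀ Z : Finset V, Z.card ≤ z → ∃ g : Fin k → Fin t → V,
        (∀ i s j s', g i s = g j s' → i = j ∧ s = s') ∧ (∀ i s, g i s ∉ Z) ∧
        ∀ τ : Fin k → Fin t, (fun i => g i (τ i)) ∈ R := by
  induction k with
  | zero =>
    intro γ hγ z
    refine ⟨0, fun {V} _ _ _ R hR Z _ => ⟨fun i => i.elim0, fun i => i.elim0, fun i => i.elim0, ?_⟩⟩
    intro τ
    have : (0 : ℝ) < R.card := hγ.trans_le (by simpa using hR)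
    obtain ⟨w, hw⟩ := card_pos.1 (by exact_mod_cast this)
    convert hw
  | succ k ih =>
    intro γ hγ z
    obtain ⟨N, γ', hγ', hN⟩ := exists_card_eq_le_card_inter.{v, v} t (half_pos hγ)
    obtain ⟨n₁, hn₁⟩ := ih hγ' (z + t)
    -- This size makes `N + z ≤ γ / 2 * n`: of the at least `γ / 2 * n` vertices with a dense link
    -- in `R`, at least `N` avoid `Z`.
    refine ⟨max n₁ (⌈2 * (N + z) / γ⌉₊ + 1), fun {V} _ _ hV R hR Z hZ => ?_⟩
    set n := Fintype.card V with hn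
    have hn1 : n₁ ≤ n := (le_max_left _ _).trans hV
    have hn2 : ⌈2 * (N + z) / γ⌉₊ + 1 ≤ n := (le_max_right _ _).trans hV
    have hnpos : (0 : ℝ) < n := by exact_mod_cast (by omega : 0 < n)
    have hnk : (0 : ℝ) < (n : ℝ) ^ k := by positivity
    have hnz : (N : ℝ) + z ≤ γ / 2 * n := by
      have h1 : 2 * (N + z) / γ ≤ ⌈2 * (N + z) / γ⌉₊ := Nat.le_ceil _
      have h2' : ⌈2 * (N + z) / γ⌉₊ ≤ n := by omega
      have h2 : (⌈2 * (N + z) / γ⌉₊ : ℝ) ≤ n := Nat.cast_le.2 h2'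
      have h3 := h1.trans h2
      rw [div_le_iff₀ hγ] at h3
      linarith
    set S : V → Finset (Fin k → V) := fun x =>
      univ.filter fun w => (Fin.cons x w : Fin (k + 1) → V) ∈ R with hS
    have hRS : R.card = ∑ x, (S x).card := by
      have h : R.card = ∑ x, (R.filter fun w => w 0 = x).card :=
        card_eq_sum_card_fiberwise fun _ _ => mem_coe.2 (mem_univ _)
      rw [h]
      refine sum_congr rfl fun x _ => ?_
      refine card_bij' (fun w _ => Fin.tail w) (fun w _ => Fin.cons x w) ?_ ?_ ?_ ?_
      · intro w hw
        obtain ⟨h1, rfl⟩ := mem_filter.1 hw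
        simpa [hS, Fin.cons_self_tail] using h1
      · intro w hw
        simpa [hS] using hw
      · intro w hw
        obtain ⟨h1, rfl⟩ := mem_filter.1 hw
        exact Fin.cons_self_tail w
      · intro w hw
        exact Fin.tail_cons _ _
    set X : Finset V := univ.filter fun x => γ / 2 * (n : ℝ) ^ k ≤ (S x).card with hX
    have hcardY : (Fintype.card (Fin k → V) : ℝ) = (n : ℝ) ^ k := by simp [hn]
    have hup : ∑ x, ((S x).card : ℝ) ≤ X.card * (n : ℝ) ^ k + n * (γ / 2 * (n : ℝ) ^ k) := by
      have h : ∀ x ∈ (univ : Finset V), ((S x).card : ℝ) ≤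
          (if γ / 2 * (n : ℝ) ^ k ≤ (S x).card then (n : ℝ) ^ k else 0) + γ / 2 * (n : ℝ) ^ k := by
        intro x _
        split_ifs with h
        · have : ((S x).card : ℝ) ≤ Fintype.card (Fin k → V) := by exact_mod_cast card_le_univ _
          have : 0 ≤ γ / 2 * (n : ℝ) ^ k := by positivity
          linarith
        · linarith
      refine (sum_le_sum h).trans ?_
      rw [sum_add_distrib, ← sum_filter, sum_const, sum_const, card_univ, nsmul_eq_mul,
        nsmul_eq_mul]
    have hXcard : γ / 2 * n ≤ X.card := by
      have h1 : (R.card : ℝ) = ∑ x, ((S x).card : ℝ) := by exact_mod_cast hRS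
      rw [pow_succ] at hR
      have : γ / 2 * n * (n : ℝ) ^ k ≤ X.card * (n : ℝ) ^ k := by linarith
      exact le_of_mul_le_mul_right this hnk
    have hXZ : N ≤ (X \ Z).card := by
      have h1 := le_card_sdiff Z X
      have h2 : N + z ≤ X.card := by exact_mod_cast hnz.trans hXcard
      omega
    -- The `t` vertices of `T` form the first part. Their common link `R'` is dense, and induction
    -- supplies the other parts there, off `Z ∪ T`.
    obtain ⟨T, hTX, hTc, R', hT, hR'⟩ := hN (X \ Z) S hXZ (fun x hx => by
      rw [hcardY]; exact (mem_filter.1 (mem_sdiff.1 hx).1).2)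
    rw [hcardY] at hT
    obtain ⟨g, hg1, hg2, hg3⟩ := hn₁ hn1 _ hT (Z ∪ T)
      ((card_union_le _ _).trans (by omega))
    let f : Fin t → V := fun s => (T.equivFin.symm (Fin.cast hTc.symm s) : V)
    have hfT : ∀ s, f s ∈ T := fun s => Subtype.coe_prop _
    have hfinj : ∀ s s', f s = f s' → s = s' := by
      intro s s' h
      simpa using T.equivFin.symm.injective (Subtype.ext h)
    refine ⟨Fin.cons f g, ?_, ?_, ?_⟩
    · intro i s j s'
      refine Fin.cases ?_ (fun i => ?_) i <;> refine Fin.cases ?_ (fun j => ?_) j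
      · simpa using hfinj s s'
      · intro h
        simp only [Fin.cons_zero, Fin.cons_succ] at h
        exact absurd (mem_union_right Z (hfT s)) (h ▸ hg2 j s')
      · intro h
        simp only [Fin.cons_zero, Fin.cons_succ] at h
        exact absurd (mem_union_right Z (hfT s')) (h ▸ hg2 i s)
      · simpa using hg1 i s j s'
    · intro i s
      refine Fin.cases ?_ (fun i => ?_) i
      · exact (mem_sdiff.1 (hTX (hfT s))).2
      · exact fun h => hg2 i s (mem_union_left _ h)
    · intro τ
      have h := (mem_filter.1 (hR' _ (hg3 (Fin.tail τ)) (f (τ 0)) (hfT _))).2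
      convert h using 1
      funext i
      refine Fin.cases ?_ (fun i => ?_) i <;> simp [Fin.tail]

open Finset in
/-- Simultaneous version of `exists_complete_partite`, with disjoint vertex sets. -/
theorem exists_complete_partite_family (Φ : Type) [Fintype Φ] (t k : ℕ) {γ : ℝ} (hγ : 0 < γ)
    (z : ℕ) :
    ∃ n₀ : ℕ, ∀ {V : Type v} [Fintype V] [DecidableEq V], n₀ ≤ Fintype.card V →
      ∀ R : Φ → Finset (Fin k → V), (∀ φ, γ * (Fintype.card V : ℝ) ^ k ≤ (R φ).card) →
      ∀ Z : Finset V, Z.card ≤ z → ∃ g : Φ → Fin k → Fin t → V,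
        (∀ φ i s ψ j s', g φ i s = g ψ j s' → φ = ψ ∧ i = j ∧ s = s') ∧
        (∀ φ i s, g φ i s ∉ Z) ∧
        ∀ φ, ∀ τ : Fin k → Fin t, (fun i => g φ i (τ i)) ∈ R φ := by
  classical
  obtain ⟨n₀, h₀⟩ := exists_complete_partite.{v} t k hγ (z + Fintype.card Φ * (k * t))
  refine ⟨n₀, fun {V} _ _ hV R hR Z hZ => ?_⟩
  suffices h : ∀ S : Finset Φ, ∃ g : Φ → Fin k → Fin t → V,
      (∀ φ ∈ S, ∀ i s, ∀ ψ ∈ S, ∀ j s', g φ i s = g ψ j s' → φ = ψ ∧ i = j ∧ s = s') ∧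
      (∀ φ ∈ S, ∀ i s, g φ i s ∉ Z) ∧
      ∀ φ ∈ S, ∀ τ : Fin k → Fin t, (fun i => g φ i (τ i)) ∈ R φ by
    obtain ⟨g, h1, h2, h3⟩ := h univ
    exact ⟨g, fun φ i s ψ j s' => h1 φ (mem_univ _) i s ψ (mem_univ _) j s',
      fun φ => h2 φ (mem_univ _), fun φ => h3 φ (mem_univ _)⟩
  intro S
  induction S using Finset.induction_on with
  | empty =>
    refine ⟨fun φ => (h₀ hV (R φ) (hR φ) Z (by omega)).choose, ?_, ?_, ?_⟩ <;> simp
  | insert φ₀ S hφ₀ ih =>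
    obtain ⟨g, h1, h2, h3⟩ := ih
    -- `W` also contains the values of `g` at indices outside `S`, which carry no information; the
    -- budget `Fintype.card Φ * (k * t)` allows for them.
    set W : Finset V := (univ : Finset (Φ × Fin k × Fin t)).image fun p => g p.1 p.2.1 p.2.2 with hW
    have hWc : W.card ≤ Fintype.card Φ * (k * t) := by
      refine card_image_le.trans ?_
      simp
    have hgW : ∀ φ i s, g φ i s ∈ W := fun φ i s =>
      mem_image.2 ⟨(φ, i, s), mem_univ _, rfl⟩
    obtain ⟨g₀, k1, k2, k3⟩ := h₀ hV (R φ₀) (hR φ₀) (Z ∪ W)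
      ((card_union_le _ _).trans (by omega))
    have hne : ∀ φ ∈ S, φ ≠ φ₀ := fun φ hφ h => hφ₀ (h ▸ hφ)
    refine ⟨Function.update g φ₀ g₀, ?_, ?_, ?_⟩
    · intro φ hφ i s ψ hψ j s' h
      rcases mem_insert.1 hφ with rfl | hφ' <;> rcases mem_insert.1 hψ with rfl | hψ'
      · rw [Function.update_self] at h
        exact ⟨rfl, k1 _ _ _ _ h⟩
      · rw [Function.update_self, Function.update_of_ne (hne _ hψ')] at h
        exact absurd (mem_union_right Z (hgW ψ j s')) (h ▸ k2 i s)
      · rw [Function.update_self, Function.update_of_ne (hne _ hφ')] at h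
        exact absurd (mem_union_right Z (hgW φ i s)) (h ▸ k2 j s')
      · rw [Function.update_of_ne (hne _ hφ'), Function.update_of_ne (hne _ hψ')] at h
        exact h1 φ hφ' i s ψ hψ' j s' h
    · intro φ hφ i s
      rcases mem_insert.1 hφ with rfl | hφ'
      · rw [Function.update_self]
        exact fun h => k2 i s (mem_union_left _ h)
      · rw [Function.update_of_ne (hne _ hφ')]
        exact h2 φ hφ' i s
    · intro φ hφ τ
      rcases mem_insert.1 hφ with rfl | hφ'
      · rw [Function.update_self]
        exact k3 τ
      · rw [Function.update_of_ne (hne _ hφ')]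
        exact h3 φ hφ' τ

/-! ### Colourings of vertex subsets -/

/-- `U` can be coloured with `k` colours so that no edge inside `U` is monochromatic; edges are
given as tuples. -/
def ColorableOn {ι : Type} {V : Type v} (E : Set (ι → V)) (U : Set V) (k : ℕ) : Prop :=
  ∃ c : V → Fin k, ∀ e ∈ E, (∀ a, e a ∈ U) → ∃ a b, c (e a) ≠ c (e b)

section ColorableOn

variable {ι : Type} {V : Type v} {E : Set (ι → V)}

theorem ColorableOn.mono {U W : Set V} {k l : ℕ} (h : ColorableOn E W k) (hUW : U ⊆ W)
    (hkl : k ≤ l) : ColorableOn E U l := by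
  obtain ⟨c, hc⟩ := h
  refine ⟨fun v => Fin.castLE hkl (c v), fun e he heU => ?_⟩
  obtain ⟨a, b, hab⟩ := hc e he fun a => hUW (heU a)
  exact ⟨a, b, fun h => hab (Fin.castLE_injective hkl h)⟩

/-- Colour `v` by a covering set containing it together with its colour there: a monochromatic edge
would lie in one covering set and be monochromatic in it. -/
theorem ColorableOn.of_cover [Nonempty ι] {κ : Type*} [Fintype κ] {U : Set V} {W : κ → Set V}
    {k : ℕ} (hU : ∀ v ∈ U, ∃ j, v ∈ W j) (hW : ∀ j, ColorableOn E (W j) k) {l : ℕ}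
    (hl : 1 ≤ l) (hkl : Fintype.card κ * k ≤ l) : ColorableOn E U l := by
  classical
  choose c hc using hW
  have e : κ × Fin k ↪ Fin l :=
    (Fintype.equivFin _).toEmbedding.trans (Fin.castLEEmb (by simpa using hkl))
  have hj : ∀ v, ∃ j : Option κ, v ∈ U → ∃ i, j = some i ∧ v ∈ W i := by
    intro v
    by_cases hv : v ∈ U
    · obtain ⟨i, hi⟩ := hU v hv
      exact ⟨some i, fun _ => ⟨i, rfl, hi⟩⟩
    · exact ⟨none, fun h => absurd h hv⟩
  choose j hj using hj
  refine ⟨fun v => (j v).elim ⟨0, hl⟩ fun i => e (i, c i v), fun f hf hfU => ?_⟩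
  by_contra! hmono
  obtain ⟨a₀⟩ := ‹Nonempty ι›
  obtain ⟨i, hi, -⟩ := hj _ (hfU a₀)
  have key : ∀ a, f a ∈ W i ∧ c i (f a) = c i (f a₀) := by
    intro a
    obtain ⟨i', hi', hW'⟩ := hj _ (hfU a)
    have := hmono a a₀
    simp only [hi, hi', Option.elim_some, e.injective.eq_iff, Prod.mk.injEq] at this
    obtain ⟨rfl, h2⟩ := this
    exact ⟨hW', h2⟩
  obtain ⟨a, b, hab⟩ := hc i f hf fun a => (key a).1
  exact hab ((key a).2.trans (key b).2.symm)

theorem ColorableOn.exists_edge {U : Set V} {k : ℕ} (hk : 1 ≤ k) (h : ¬ ColorableOn E U k) :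
    ∃ e ∈ E, ∀ a, e a ∈ U := by
  by_contra! h'
  exact h ⟨fun _ => ⟨0, hk⟩, fun e he heU => absurd heU (by simpa using h' e he)⟩

end ColorableOn

/-! ### Edges whose fibers intersect densely -/

section Spread

open Finset

/-- If every edge `e` in `U` is well spread only with respect to a set of small chromatic number,
then a set `W ⊆ U` of large chromatic number contains a long list of vertices that are pairwise
badly spread. -/
theorem exists_list_pairwise {ι Φ : Type} [Fintype ι] [Nonempty ι] [Fintype Φ] {V : Type v}
    {E : Set (ι → V)} (Q : V → Φ → V → Prop) {U : Set V} {k : ℕ} (hk : 1 ≤ k)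
    (hU : ∀ e ∈ E, (∀ a, e a ∈ U) →
      ColorableOn E {v | v ∈ U ∧ ∀ φ a, ¬ Q (e a) φ v} k) (N : ℕ) :
    ∀ W ⊆ U, ¬ ColorableOn E W ((Fintype.card (Option (Φ × ι)) + 1) ^ N * k) →
      ∃ l : List (V × Φ), l.length = N ∧ (∀ p ∈ l, p.1 ∈ W) ∧
        l.Pairwise fun p q => Q p.1 p.2 q.1 := by
  induction N with
  | zero => exact fun W _ _ => ⟨[], by simp⟩
  | succ N ih =>
    intro W hWU hW
    have hpos : 1 ≤ (Fintype.card (Option (Φ × ι)) + 1) ^ N * k :=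
      Nat.one_le_iff_ne_zero.2 (by positivity)
    have hpos' : 1 ≤ (Fintype.card (Option (Φ × ι)) + 1) ^ (N + 1) * k :=
      Nat.one_le_iff_ne_zero.2 (by positivity)
    obtain ⟨e, he, heW⟩ := ColorableOn.exists_edge hpos' hW
    have hex : ∃ p : Φ × ι, ¬ ColorableOn E {v | v ∈ W ∧ Q (e p.2) p.1 v}
        ((Fintype.card (Option (Φ × ι)) + 1) ^ N * k) := by
      by_contra! hall
      -- `W` is covered by the well spread vertices, of small chromatic number by `hU`, and one set
      -- for each way `(φ, a)` of being badly spread. Hence one of the latter keeps a large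
      -- chromatic number, and the list continues inside it.
      refine hW (ColorableOn.of_cover (κ := Option (Φ × ι))
        (W := fun o => o.elim {v | v ∈ U ∧ ∀ φ a, ¬ Q (e a) φ v}
          fun p => {v | v ∈ W ∧ Q (e p.2) p.1 v})
        (k := (Fintype.card (Option (Φ × ι)) + 1) ^ N * k) ?_ ?_ hpos' ?_)
      · intro v hv
        by_cases h : ∀ φ a, ¬ Q (e a) φ v
        · exact ⟨none, hWU hv, h⟩
        · push Not at h
          obtain ⟨φ, a, h⟩ := h
          exact ⟨some (φ, a), hv, h⟩
      · rintro (_ | p)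
        · exact (hU e he fun a => hWU (heW a)).mono subset_rfl
            (Nat.le_mul_of_pos_left _ (by positivity))
        · exact hall p
      · rw [pow_succ', mul_assoc]
        gcongr
        omega
    obtain ⟨⟨φ, a⟩, hp⟩ := hex
    obtain ⟨l, hl, hlW, hlQ⟩ := ih _ (fun v hv => hWU hv.1) hp
    refine ⟨(e a, φ) :: l, by simp [hl], ?_, ?_⟩
    · intro p hp
      rcases List.mem_cons.1 hp with rfl | hp
      · exact heW a
      · exact (hlW p hp).1
    · exact List.pairwise_cons.2 ⟨fun q hq => (hlW q hq).2, hlQ⟩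

/-- One step of the construction: an edge whose fibers all have dense intersection with the given
sets `A φ` and with the fibers of many vertices, in the sense of chromatic number. -/
theorem exists_edge_spread {ι Φ : Type} [Fintype ι] [Nonempty ι] [Fintype Φ] {γ : ℝ}
    (hγ : 0 < γ) :
    ∃ γ' : ℝ, 0 < γ' ∧ ∀ k : ℕ, ∃ K : ℕ, ∀ {V Y : Type v} [Fintype Y] [DecidableEq Y]
      (E : Set (ι → V)) (L : V → Finset Y) (A : Φ → Finset Y) (U : Set V),
      (∀ v ∈ U, ∀ φ, γ * Fintype.card Y ≤ (L v ∩ A φ).card) → ¬ ColorableOn E U K →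
      ∃ e ∈ E, (∀ a, e a ∈ U) ∧ ¬ ColorableOn E
        {v | v ∈ U ∧ ∀ φ a, γ' * Fintype.card Y ≤ (L v ∩ (L (e a) ∩ A φ)).card} k := by
  classical
  obtain ⟨N, γ', hγ', hN⟩ := exists_card_eq_le_card_inter.{0, v} 2 hγ
  refine ⟨γ', hγ', fun k =>
    ⟨(Fintype.card (Option (Φ × ι)) + 1) ^ (Fintype.card Φ * N + 1) * (k + 1), ?_⟩⟩
  intro V Y _ _ E L A U hU hUK
  by_contra! hcon
  obtain ⟨l, hl, hlU, hlQ⟩ := exists_list_pairwise (E := E) (U := U)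
    (fun w φ v => ((L v ∩ (L w ∩ A φ)).card : ℝ) < γ' * Fintype.card Y)
    (Nat.le_add_left 1 k)
    (fun e he heU => by
      simp only [not_lt]
      exact (hcon e he heU).mono subset_rfl (Nat.le_succ k))
    (Fintype.card Φ * N + 1) U subset_rfl hUK
  -- The list has `Fintype.card Φ * N + 1` entries, so at least `N` share the same `φ`. Two of their
  -- dense sets `L v ∩ A φ` then have a dense intersection, against pairwise bad spread.
  obtain ⟨φ, hφ⟩ : ∃ φ : Φ, N ≤ (univ.filter fun i : Fin l.length => (l.get i).2 = φ).card := by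
    obtain ⟨φ, -, hφ⟩ := exists_lt_card_fiber_of_mul_lt_card_of_maps_to
      (s := (univ : Finset (Fin l.length))) (t := (univ : Finset Φ))
      (f := fun i => (l.get i).2) (n := N) (fun _ _ => mem_univ _) (by simp [hl])
    exact ⟨φ, hφ.le⟩
  obtain ⟨T, hTI, hTc, S, hS, hST⟩ := hN _ (fun i => L (l.get i).1 ∩ A φ) hφ
    (fun i _ => hU _ (hlU _ (List.get_mem _ _)) φ)
  -- The list relation goes only from earlier to later entries, hence the ordering.
  obtain ⟨i, j, hij, rfl⟩ : ∃ i j, i < j ∧ T = {i, j} := by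
    obtain ⟨i, j, hij, rfl⟩ := card_eq_two.1 hTc
    rcases lt_or_gt_of_ne hij with h | h
    · exact ⟨i, j, h, rfl⟩
    · exact ⟨j, i, h, pair_comm i j⟩
  have hi : (l.get i).2 = φ := (mem_filter.1 (hTI (mem_insert_self _ _))).2
  have hlt := List.pairwise_iff_get.1 hlQ i j hij
  rw [hi] at hlt
  refine (hS.trans (Nat.cast_le.2 (card_le_card ?_))).not_gt hlt
  intro y hy
  have h := hST y hy
  simp only [mem_insert, mem_singleton, forall_eq_or_imp, forall_eq, mem_inter] at h ⊢
  tauto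

/-- A hypergraph with dense fibers and large chromatic number contains `m` disjoint edges such
that the chromatic number is large on the vertices whose fibers have a dense intersection with
each intersection of fibers of vertices chosen one from each of the `m` edges. -/
theorem exists_edges_spread {ι : Type} [Fintype ι] [Nontrivial ι] {ε : ℝ} (hε : 0 < ε)
    (m : ℕ) : ∃ γ : ℝ, 0 < γ ∧ ∀ k : ℕ, ∃ K : ℕ, ∀ {V Y : Type v} [Fintype Y] [DecidableEq Y]
      (E : Set (ι → V)) (L : V → Finset Y), (∀ e ∈ E, Function.Injective e) →
      (∀ v, ε * Fintype.card Y ≤ (L v).card) → ¬ ColorableOn E Set.univ K →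
      ∃ e : Fin m → ι → V, (∀ i, e i ∈ E) ∧
        (∀ i a j b, e i a = e j b → i = j ∧ a = b) ∧
        ∃ U : Set V, (∀ v ∈ U, ∀ i a, v ≠ e i a) ∧
          (∀ v ∈ U, ∀ φ : Fin m → ι, γ * Fintype.card Y ≤
            (L v ∩ univ.filter fun y => ∀ i, y ∈ L (e i (φ i))).card) ∧
          ¬ ColorableOn E U k := by
  classical
  induction m with
  | zero =>
    refine ⟨ε, hε, fun k => ⟨k, fun {V Y} _ _ E L _ hL hE => ⟨fun i => i.elim0, fun i => i.elim0,
      fun i => i.elim0, Set.univ, fun _ _ i => i.elim0, fun v _ φ => ?_, hE⟩⟩⟩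
    simpa using hL v
  | succ m ih =>
    obtain ⟨γ, hγ, ih⟩ := ih
    obtain ⟨γ', hγ', hstep⟩ := exists_edge_spread.{v} (ι := ι) (Φ := Fin m → ι) hγ
    refine ⟨γ', hγ', fun k => ?_⟩
    -- The factor pays for deleting the vertices of the new edge from `U`. Since `γ'` does not
    -- depend on the number of colours, `K₁` can be fed back into the induction.
    obtain ⟨K₁, hK₁⟩ := hstep (Fintype.card (Option ι) * (k + 1))
    obtain ⟨K₂, hK₂⟩ := ih K₁
    refine ⟨K₂, fun {V Y} _ _ E L hinj hL hE => ?_⟩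
    obtain ⟨e, he, hdisj, U, hU1, hU2, hU3⟩ := hK₂ E L hinj hL hE
    obtain ⟨f, hf, hfU, hfK⟩ := hK₁ E L _ U hU2 hU3
    refine ⟨Fin.cons f e, ?_, ?_, {v | v ∈ U ∧ (∀ φ : Fin m → ι, ∀ a, γ' * Fintype.card Y ≤
      (L v ∩ (L (f a) ∩ univ.filter fun y => ∀ i, y ∈ L (e i (φ i)))).card) ∧ ∀ a, v ≠ f a},
      ?_, ?_, ?_⟩
    · exact Fin.cases hf he
    · intro i a j b
      refine Fin.cases ?_ (fun i => ?_) i <;> refine Fin.cases ?_ (fun j => ?_) j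
      · exact fun h => ⟨rfl, hinj f hf h⟩
      · exact fun h => absurd h (hU1 _ (hfU a) j b)
      · exact fun h => absurd h.symm (hU1 _ (hfU b) i a)
      · simpa using hdisj i a j b
    · intro v hv i a
      refine Fin.cases ?_ (fun i => ?_) i
      · exact hv.2.2 a
      · exact hU1 v hv.1 i a
    · intro v hv φ
      refine (hv.2.1 (Fin.tail φ) (φ 0)).trans (Nat.cast_le.2 (card_le_card ?_))
      intro y hy
      simp only [mem_inter, mem_filter, mem_univ, true_and] at hy ⊢
      exact ⟨hy.1, Fin.cases hy.2.1 hy.2.2⟩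
    · intro hcol
      refine hfK (ColorableOn.of_cover (κ := Option ι) (k := k + 1) (W := fun o => o.elim
        {v | v ∈ U ∧ (∀ φ : Fin m → ι, ∀ a, γ' * Fintype.card Y ≤
          (L v ∩ (L (f a) ∩ univ.filter fun y => ∀ i, y ∈ L (e i (φ i)))).card) ∧ ∀ a, v ≠ f a}
        fun a => {f a}) ?_ ?_ (Nat.one_le_iff_ne_zero.2 (by simp)) le_rfl)
      · intro v hv
        by_cases h : ∀ a, v ≠ f a
        · exact ⟨none, hv.1, hv.2, h⟩
        · push Not at h
          obtain ⟨a, ha⟩ := h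
          exact ⟨some a, ha⟩
      · rintro (_ | a)
        · exact hcol.mono subset_rfl (Nat.le_succ k)
        · refine ⟨fun _ => 0, fun g hg hga => ?_⟩
          obtain ⟨b, c, hbc⟩ := exists_pair_ne ι
          exact absurd (hinj g hg ((hga b).trans (hga c).symm)) hbc

/-- A hypergraph with dense fibers and large chromatic number contains `m` disjoint edges such
that every choice of one vertex from each gives fibers with a dense intersection. -/
theorem exists_edges_shattered {ι : Type} [Fintype ι] [Nontrivial ι] {ε : ℝ} (hε : 0 < ε)
    (m : ℕ) : ∃ γ : ℝ, 0 < γ ∧ ∃ K : ℕ, ∀ {V Y : Type v} [Fintype Y] [DecidableEq Y]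
      (E : Set (ι → V)) (L : V → Finset Y), (∀ e ∈ E, Function.Injective e) →
      (∀ v, ε * Fintype.card Y ≤ (L v).card) → ¬ ColorableOn E Set.univ K →
      ∃ e : Fin m → ι → V, (∀ i, e i ∈ E) ∧
        (∀ i a j b, e i a = e j b → i = j ∧ a = b) ∧
        ∀ φ : Fin m → ι, γ * Fintype.card Y ≤
          (univ.filter fun y => ∀ i, y ∈ L (e i (φ i))).card := by
  obtain ⟨γ, hγ, h⟩ := exists_edges_spread.{v} (ι := ι) hε m
  obtain ⟨K, hK⟩ := h 1
  refine ⟨γ, hγ, K, fun {V Y} _ _ E L hinj hL hE => ?_⟩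
  obtain ⟨e, he, hdisj, U, -, hU2, hU3⟩ := hK E L hinj hL hE
  obtain ⟨f, -, hf⟩ := ColorableOn.exists_edge le_rfl hU3
  obtain ⟨a, -⟩ := exists_pair_ne ι
  exact ⟨e, he, hdisj, fun φ => (hU2 _ (hf a) φ).trans
    (Nat.cast_le.2 (card_le_card inter_subset_right))⟩

end Spread

/-! ### Encoding a near partition with extendible components -/

namespace Hypergraph

/-- The component of `x` in `H`. -/
def componentOf {α : Type u} (H : Hypergraph α) (x : α) : Hypergraph α :=
  H.induce {y | Relation.ReflTransGen H.Adj x y}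

theorem isComponent_componentOf {α : Type u} {H : Hypergraph α} {x : α} (hx : x ∈ V(H)) :
    H.IsComponent (H.componentOf x) :=
  ⟨x, hx, rfl⟩

theorem mem_componentOf_self {α : Type u} {H : Hypergraph α} {x : α} (hx : x ∈ V(H)) :
    x ∈ V(H.componentOf x) :=
  ⟨hx, .refl⟩

theorem componentOf_eq_of_adj {α : Type u} {H : Hypergraph α} {x y : α} (h : H.Adj x y) :
    H.componentOf x = H.componentOf y := by
  have : {z | Relation.ReflTransGen H.Adj x z} = {z | Relation.ReflTransGen H.Adj y z} :=
    Set.ext fun z => ⟨fun hz => .head h.symm hz, fun hz => .head h hz⟩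
  rw [componentOf, this, componentOf]

theorem mem_edgeSet_componentOf {α : Type u} {H : Hypergraph α} {x : α} {e : Set α}
    (he : e ∈ E(H)) (hx : x ∈ e) : e ∈ E(H.componentOf x) :=
  ⟨he, fun _ hy => .single ⟨e, he, hx, hy⟩⟩

/-- In a partial matching, vertices in the same component are equal or in a common edge. -/
theorem IsPartialMatching.eq_or_adj {α : Type u} {H : Hypergraph α} (hH : H.IsPartialMatching)
    {x y : α} (h : Relation.ReflTransGen H.Adj x y) : x = y ∨ H.Adj x y := by
  induction h with
  | refl => exact .inl rfl
  | tail _ h ih =>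
    rcases ih with rfl | ⟨e, he, hx, hy⟩
    · exact .inr h
    · obtain ⟨e', he', hy', hz⟩ := h
      have : e = e' := by
        by_contra hne
        exact Set.disjoint_left.1 (hH e he e' he' hne) hy hy'
      exact .inr ⟨e, he, hx, this ▸ hz⟩

theorem IsUniform.image_eq_univ {α : Type u} {H : Hypergraph α} {r : ℕ} (hH : H.IsUniform r)
    {e : Set α} (he : e ∈ E(H)) {f : α → Fin r} (hf : Set.InjOn f e) : f '' e = Set.univ := by
  refine Set.eq_of_subset_of_ncard_le (Set.subset_univ _) ?_
  rw [hf.ncard_image, hH.ncard_eq e he, Set.ncard_univ, Nat.card_eq_fintype_card, Fintype.card_fin]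

/-- `H` maps homomorphically, and injectively on the part `0`, to the hypergraph made of `m`
disjoint edges, with vertices labelled by `Fin r`, and for each map `ψ : Fin m → Fin r`
of a complete `(r - 1)`-partite hypergraph whose edges are extended by the vertex of label
`ψ i` in each edge `i`. Here `part` is the part of a vertex, `pos` is the image of a vertex of the
part `0`, and `pat` is the map `ψ` of a vertex in another part. -/
structure MatchingEncoding {α : Type u} (H : Hypergraph α) (r m : ℕ) [NeZero r] where
  part : α → Fin r
  pos : α → Fin m × Fin r
  pat : α → Fin m → Fin r
  pos_inj : ∀ x ∈ V(H), ∀ y ∈ V(H), part x = 0 → part y = 0 → pos x = pos y → x = y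
  edge : ∀ e ∈ E(H), (∃ i, (∀ x ∈ e, part x = 0 ∧ (pos x).1 = i) ∧ ∀ a, ∃ x ∈ e, pos x = (i, a)) ∨
    ∃ x ∈ e, ∃ ψ : Fin m → Fin r, part x = 0 ∧ ψ (pos x).1 = (pos x).2 ∧
      (∀ y ∈ e, y ≠ x → part y ≠ 0 ∧ pat y = ψ) ∧ ∀ j, ∃ y ∈ e, part y = j ∧ ∀ z ∈ e, part z = j → z = y

/-- The position of a vertex of `P 0` is the index of its component with its class in the
extendibility partition. The pattern of a vertex of `Y` records, for each component of `H[P 0]`, the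
only class to which its own component of `H|_Y` extends. -/
theorem IsNearPartition.exists_matchingEncoding {α : Type u} {r : ℕ} [NeZero r] (hr : 2 ≤ r)
    {H : Hypergraph α} (hH : H.IsUniform r) {P : Fin r → Set α} (hP : H.IsNearPartition P)
    (hext : ∀ D : Hypergraph α, (H.induce (P 0)).IsComponent D →
      H.PartiteExtendible r V(D) (⋃ (i : Fin r) (_ : i ≠ 0), P i)) :
    ∃ m, Nonempty (H.MatchingEncoding r m) := by
  classical
  set Y : Set α := ⋃ (i : Fin r) (_ : i ≠ 0), P i with hY
  set H₀ := H.induce (P 0) with hH₀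
  have hP0 : P 0 ⊆ V(H) := hP.isPartition.iUnion_eq ▸ Set.subset_iUnion P 0
  have hV₀ : V(H₀) = P 0 := Set.inter_eq_right.2 hP0
  have hmemY : ∀ x, x ∈ Y ↔ ∃ i : Fin r, i ≠ 0 ∧ x ∈ P i := by simp [hY]
  have huniq : ∀ x i j, x ∈ P i → x ∈ P j → i = j := by
    intro x i j hi hj
    by_contra hne
    exact Set.disjoint_left.1 (hP.isPartition.disjoint i j hne) hi hj
  have hpart : ∀ x, ∃ i, x ∈ V(H) → x ∈ P i := by
    intro x
    by_cases hx : x ∈ V(H)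
    · rw [← hP.isPartition.iUnion_eq] at hx
      obtain ⟨i, hi⟩ := Set.mem_iUnion.1 hx
      exact ⟨i, fun _ => hi⟩
    · exact ⟨0, fun h => absurd h hx⟩
  choose part hpart using hpart
  have hpart_eq : ∀ x i, x ∈ P i → part x = i := fun x i hx =>
    huniq x _ _ (hpart x (hP.isPartition.iUnion_eq ▸ Set.mem_iUnion.2 ⟨i, hx⟩)) hx
  choose Q hQpart hQind hQext using hext
  let K := {D : Hypergraph α // H₀.IsComponent D}
  have hK : Finite K := by
    have hfin : (H₀.componentOf '' V(H₀)).Finite :=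
      (hV₀ ▸ hH.finite_vertexSet.subset hP0 : V(H₀).Finite).image _
    refine (hfin.subset ?_ : {D | H₀.IsComponent D}.Finite).to_subtype
    rintro D ⟨x, hx, rfl⟩
    exact ⟨x, hx, rfl⟩
  obtain ⟨m₀, ⟨idx₀⟩⟩ := Finite.exists_equiv_fin K
  -- The spare index makes `Fin (m + 1)` nonempty, so that `pos` has a default value.
  obtain ⟨m, idx, hidx⟩ : ∃ m : ℕ, ∃ idx : K → Fin (m + 1), Function.Injective idx :=
    ⟨m₀, fun D => (idx₀ D).castSucc, fun D D' h => idx₀.injective (Fin.castSucc_injective _ h)⟩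
  have hpos : ∀ x, ∃ p : Fin (m + 1) × Fin r, ∀ hx : x ∈ V(H₀),
      p.1 = idx ⟨_, isComponent_componentOf hx⟩ ∧ x ∈ Q _ (isComponent_componentOf hx) p.2 := by
    intro x
    by_cases hx : x ∈ V(H₀)
    · have : x ∈ ⋃ i, Q _ (isComponent_componentOf hx) i := by
        rw [(hQpart _ _).iUnion_eq]
        exact mem_componentOf_self hx
      obtain ⟨a, ha⟩ := Set.mem_iUnion.1 this
      exact ⟨(idx ⟨_, isComponent_componentOf hx⟩, a), fun _ => ⟨rfl, ha⟩⟩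
    · exact ⟨0, fun h => absurd h hx⟩
  choose pos hpos using hpos
  -- Each component of the restriction to the other parts extends to at most one label.
  let Ext : Hypergraph α → K → Fin r → Prop := fun C D a =>
    ∃ x ∈ Q D.1 D.2 a, ∃ e ∈ E(C), e ∪ {x} ∈ E(H)
  have hpat : ∀ C, ∃ ψ : Fin (m + 1) → Fin r, (H.restrict Y).IsComponent C →
      ∀ D a, Ext C D a → ψ (idx D) = a := by
    intro C
    have : ∀ i, ∃ b : Fin r, (H.restrict Y).IsComponent C →
        ∀ D a, idx D = i → Ext C D a → b = a := by
      intro i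
      by_cases h : ∃ D a, idx D = i ∧ Ext C D a
      · obtain ⟨D, a, hD, x, hx, e, he, hex⟩ := h
        refine ⟨a, fun hC D' a' hD' ⟨x', hx', e', he', hex'⟩ => ?_⟩
        obtain rfl : D' = D := hidx (hD'.trans hD.symm)
        by_contra hne
        exact hQext D'.1 D'.2 C hC
          ⟨a, a', hne, x, hx, x', hx', e, he, e', he', hex, hex'⟩
      · exact ⟨0, fun _ D a hD hE => absurd ⟨D, a, hD, hE⟩ h⟩
    choose ψ hψ using this
    exact ⟨ψ, fun hC D a hE => hψ _ hC D a rfl hE⟩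
  choose pat hpat using hpat
  have hQcongr : ∀ {D D' : Hypergraph α} (_ : D = D') (hD : H₀.IsComponent D)
      (hD' : H₀.IsComponent D') {y a}, y ∈ Q D hD a → y ∈ Q D' hD' a := by
    rintro D _ rfl hD hD' y a h
    exact h
  -- Equal positions mean the same class of the same component, and classes are strongly
  -- independent.
  have hlabel : ∀ e ∈ E(H), ∀ x ∈ e, ∀ y ∈ e, x ∈ V(H₀) → y ∈ V(H₀) → pos x = pos y → x = y := by
    intro e he x hxe y hye hx hy hxy
    have h1 := hpos x hx
    have h2 := hpos y hy
    have h3 : (⟨_, isComponent_componentOf hx⟩ : K) = ⟨_, isComponent_componentOf hy⟩ :=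
      hidx (h1.1.symm.trans ((congrArg Prod.fst hxy).trans h2.1))
    have h4 : H₀.componentOf x = H₀.componentOf y := congrArg Subtype.val h3
    have h5 : y ∈ Q _ (isComponent_componentOf hx) (pos x).2 := by
      rw [hxy]
      exact hQcongr h4.symm _ _ h2.2
    exact hQind _ _ _ e he ⟨hxe, h1.2⟩ ⟨hye, h5⟩
  refine ⟨m + 1, ⟨⟨part, pos, fun y => pat ((H.restrict Y).componentOf y), ?_, ?_⟩⟩⟩
  · intro x hxV y hyV hx hy hxy
    have hx' : x ∈ V(H₀) := hV₀ ▸ hx ▸ hpart x hxV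
    have hy' : y ∈ V(H₀) := hV₀ ▸ hy ▸ hpart y hyV
    have h3 : (⟨_, isComponent_componentOf hx'⟩ : K) = ⟨_, isComponent_componentOf hy'⟩ :=
      hidx ((hpos x hx').1.symm.trans ((congrArg Prod.fst hxy).trans (hpos y hy').1))
    have h4 : H₀.componentOf x = H₀.componentOf y := congrArg Subtype.val h3
    have h5 : y ∈ V(H₀.componentOf x) := h4 ▸ mem_componentOf_self hy'
    -- A component of a partial matching is a vertex or one edge, so `hlabel` applies.
    rcases hP.isPartialMatching.eq_or_adj h5.2 with h | ⟨e, he, hxe, hye⟩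
    · exact h
    · exact hlabel e he.1 x hxe y hye hx' hy' hxy
  · intro e he
    have heV := H.subset_vertexSet_of_mem_edgeSet he
    rcases hP.crossing_or_subset e he with hcr | hsub
    · right
      obtain ⟨x, hx⟩ := Set.ncard_eq_one.1 (hcr 0)
      have hxe : x ∈ e ∩ P 0 := hx ▸ rfl
      have hx' : x ∈ V(H₀) := hV₀ ▸ hxe.2
      have hne : ∀ y ∈ e, y ≠ x → y ∈ Y := by
        intro y hy hyx
        refine (hmemY y).2 ⟨part y, fun h => hyx ?_, hpart y (heV hy)⟩
        have : y ∈ e ∩ P 0 := ⟨hy, h ▸ hpart y (heV hy)⟩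
        rwa [hx] at this
      have hxY : x ∉ Y := by
        intro h
        obtain ⟨i, hi, hxi⟩ := (hmemY x).1 h
        exact hi (huniq x i 0 hxi hxe.2)
      have heY : e ∩ Y ∪ {x} = e := by
        ext y
        simp only [Set.mem_union, Set.mem_inter_iff, Set.mem_singleton_iff]
        constructor
        · rintro (h | rfl)
          · exact h.1
          · exact hxe.1
        · intro hy
          by_cases hyx : y = x
          · exact .inr hyx
          · exact .inl ⟨hy, hne y hy hyx⟩
      have heYE : e ∩ Y ∈ E(H.restrict Y) := ⟨e, he, rfl⟩
      -- As `r ≥ 2`, the edge meets `P 1`; the vertex `z` names the component of `H|_Y` containing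
      -- `e ∩ Y`.
      obtain ⟨z, hz⟩ : (e ∩ P ⟨1, hr⟩).Nonempty := by
        rw [← Set.ncard_pos ((hH.finite_vertexSet.subset heV).subset Set.inter_subset_left),
          hcr]
        exact one_pos
      have h10 : (⟨1, hr⟩ : Fin r) ≠ 0 := by
        intro h
        simpa using congrArg Fin.val h
      have hzY : z ∈ Y := (hmemY z).2 ⟨_, h10, hz.2⟩
      have hzV : z ∈ V(H.restrict Y) := ⟨heV hz.1, hzY⟩
      refine ⟨x, hxe.1, pat ((H.restrict Y).componentOf z), hpart_eq _ _ hxe.2, ?_, ?_, ?_⟩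
      · rw [(hpos x hx').1]
        refine hpat _ (isComponent_componentOf hzV) _ _
          ⟨x, (hpos x hx').2, e ∩ Y, mem_edgeSet_componentOf heYE ⟨hz.1, hzY⟩, ?_⟩
        rw [heY]
        exact he
      · intro y hy hyx
        have hyY := hne y hy hyx
        refine ⟨fun h => ?_, ?_⟩
        · obtain ⟨i, hi, hyi⟩ := (hmemY y).1 hyY
          exact hi (huniq y i 0 hyi (h ▸ hpart y (heV hy)))
        · rw [componentOf_eq_of_adj ⟨_, heYE, ⟨hy, hyY⟩, ⟨hz.1, hzY⟩⟩]
      · intro j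
        obtain ⟨y, hy⟩ := Set.ncard_eq_one.1 (hcr j)
        have hye : y ∈ e ∩ P j := hy ▸ rfl
        refine ⟨y, hye.1, hpart_eq y j hye.2, fun z hz hzj => ?_⟩
        have : z ∈ e ∩ P j := ⟨hz, hzj ▸ hpart z (heV hz)⟩
        rwa [hy] at this
    · left
      have heV₀ : ∀ x ∈ e, x ∈ V(H₀) := fun x hx => hV₀ ▸ hsub hx
      obtain ⟨x, hx⟩ : e.Nonempty := by
        rw [← Set.ncard_pos (hH.finite_vertexSet.subset heV), hH.ncard_eq e he]
        omega
      have hfst : ∀ y ∈ e, (pos y).1 = (pos x).1 := by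
        intro y hy
        rw [(hpos y (heV₀ y hy)).1, (hpos x (heV₀ x hx)).1]
        congr 2
        exact componentOf_eq_of_adj ⟨e, ⟨he, hsub⟩, hy, hx⟩
      refine ⟨(pos x).1, fun y hy => ⟨hpart_eq y 0 (hsub hy), hfst y hy⟩, fun a => ?_⟩
      have hinj : Set.InjOn (fun y => (pos y).2) e := fun y hy z hz hyz =>
        hlabel e he y hy z hz (heV₀ y hy) (heV₀ z hz)
          (Prod.ext ((hfst y hy).trans (hfst z hz).symm) hyz)
      have ha : a ∈ (fun y => (pos y).2) '' e := hH.image_eq_univ he hinj ▸ Set.mem_univ a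
      obtain ⟨y, hy, rfl⟩ := ha
      exact ⟨y, hy, Prod.ext (hfst y hy) rfl⟩

/-! ### Embedding into the host hypergraph -/

open Finset

/-- A hypergraph with a matching encoding embeds into each hypergraph that contains disjoint edges
and complete multipartite pieces in the intersections of the links of their vertices. -/
theorem MatchingEncoding.isSubhypergraph {α : Type u} {β : Type v} {H : Hypergraph α}
    {G : Hypergraph β} {k m t : ℕ} {inst : NeZero (k + 1)} (enc : H.MatchingEncoding (k + 1) m)
    (ι : V(H) → Fin t) (hι : Function.Injective ι)
    (e : Fin m → Fin (k + 1) → β) (he : ∀ i, Set.range (e i) ∈ E(G))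
    (he_inj : ∀ i a j b, e i a = e j b → i = j ∧ a = b)
    (g : (Fin m → Fin (k + 1)) → Fin k → Fin t → β) (hgV : ∀ ψ j s, g ψ j s ∈ V(G))
    (hg_inj : ∀ φ i s ψ j s', g φ i s = g ψ j s' → φ = ψ ∧ i = j ∧ s = s')
    (hge : ∀ ψ j s i a, g ψ j s ≠ e i a)
    (hg : ∀ ψ (τ : Fin k → Fin t) i, insert (e i (ψ i)) (Set.range fun j => g ψ j (τ j)) ∈ E(G)) :
    H.IsSubhypergraph G := by
  classical
  -- `Fin.pred` and `Fin.succ` refer to the standard zero of `Fin (k + 1)`, with which the zero of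
  -- `enc` must agree.
  obtain rfl : inst = ⟨Nat.succ_ne_zero k⟩ := Subsingleton.elim _ _
  obtain ⟨part, pos, pat, pos_inj, hedge⟩ := enc
  let f : V(H) → β := fun x => if h : part x = 0 then e (pos x).1 (pos x).2
    else g (pat x) ((part x).pred h) (ι x)
  have hf0 : ∀ x : V(H), part x = 0 → f x = e (pos x).1 (pos x).2 := fun x h => dif_pos h
  have hf1 : ∀ (x : V(H)) (h : part x ≠ 0), f x = g (pat x) ((part x).pred h) (ι x) :=
    fun x h => dif_neg h
  refine ⟨f, ?_, ?_, ?_⟩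
  · intro x y hxy
    by_cases hx : part x = 0 <;> by_cases hy : part y = 0
    · rw [hf0 x hx, hf0 y hy] at hxy
      have := he_inj _ _ _ _ hxy
      exact Subtype.ext (pos_inj x x.2 y y.2 hx hy (Prod.ext this.1 this.2))
    · rw [hf0 x hx, hf1 y hy] at hxy
      exact absurd hxy.symm (hge _ _ _ _ _)
    · rw [hf1 x hx, hf0 y hy] at hxy
      exact absurd hxy (hge _ _ _ _ _)
    -- The slot `ι x` alone separates vertices outside part `0`, whatever their parts and patterns.
    · rw [hf1 x hx, hf1 y hy] at hxy
      exact hι (hg_inj _ _ _ _ _ _ hxy).2.2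
  · intro x
    by_cases hx : part x = 0
    · rw [hf0 x hx]
      exact G.subset_vertexSet_of_mem_edgeSet (he _) ⟨_, rfl⟩
    · rw [hf1 x hx]
      exact hgV _ _ _
  · intro d hd
    have hdV := H.subset_vertexSet_of_mem_edgeSet hd
    rcases hedge d hd with ⟨i, h1, h2⟩ | ⟨x, hxd, ψ, hx0, hψ, h1, h2⟩
    · convert he i using 1
      ext z
      constructor
      · rintro ⟨y, hy, rfl⟩
        rw [hf0 y (h1 y hy).1, (h1 y hy).2]
        exact ⟨_, rfl⟩
      · rintro ⟨a, rfl⟩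
        obtain ⟨y, hy, hya⟩ := h2 a
        refine ⟨⟨y, hdV hy⟩, hy, ?_⟩
        rw [hf0 _ (h1 y hy).1, hya]
    · choose y hyd hy hyu using fun j : Fin k => h2 j.succ
      have hy0 : ∀ j, part (y j) ≠ 0 := fun j => by rw [hy]; exact Fin.succ_ne_zero j
      have hfy : ∀ j, f ⟨y j, hdV (hyd j)⟩ = g ψ j (ι ⟨y j, hdV (hyd j)⟩) := by
        intro j
        have hyx : y j ≠ x := fun h => hy0 j (h ▸ hx0)
        rw [hf1 _ (hy0 j)]
        simp only [(h1 _ (hyd j) hyx).2, hy, Fin.pred_succ]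
      have hfx : f ⟨x, hdV hxd⟩ = e (pos x).1 (ψ (pos x).1) := by
        rw [hf0 _ hx0, hψ]
      convert hg ψ (fun j => ι ⟨y j, hdV (hyd j)⟩) (pos x).1 using 1
      ext z
      simp only [Set.mem_insert_iff, Set.mem_range, ← hfx, ← hfy]
      constructor
      · rintro ⟨⟨w, hwV⟩, hw, rfl⟩
        by_cases hwx : w = x
        · subst hwx
          exact .inl rfl
        · refine .inr ⟨(part w).pred (h1 w hw hwx).1, ?_⟩
          congr 2
          exact (hyu _ w hw (Fin.succ_pred _ _).symm).symm
      · rintro (rfl | ⟨j, rfl⟩)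
        · exact ⟨⟨x, hdV hxd⟩, hxd, rfl⟩
        · exact ⟨⟨y j, hdV (hyd j)⟩, hyd j, rfl⟩

/-! ### Ordered edges, links and the degree condition -/

/-- The ordered edges of `G`. -/
def edgeTuples {β : Type v} (G : Hypergraph β) (r : ℕ) : Set (Fin r → V(G)) :=
  {f | Set.range (fun a => (f a : β)) ∈ E(G)}

theorem exists_range_eq {β : Type v} {V s : Set β} {n : ℕ} (hs : s ⊆ V) (hfin : s.Finite)
    (hn : s.ncard = n) : ∃ f : Fin n → V, Set.range (fun a => (f a : β)) = s := by
  have := hfin.to_subtype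
  let φ : s ≃ Fin n := Finite.equivFinOfCardEq hn
  refine ⟨fun a => ⟨φ.symm a, hs (φ.symm a).2⟩, ?_⟩
  ext x
  constructor
  · rintro ⟨a, rfl⟩
    exact (φ.symm a).2
  · exact fun hx => ⟨φ ⟨x, hx⟩, by simp⟩

theorem IsUniform.injective_of_mem_edgeTuples {β : Type v} {G : Hypergraph β} {r : ℕ}
    (hG : G.IsUniform r) {f : Fin r → V(G)} (hf : f ∈ G.edgeTuples r) : Function.Injective f := by
  have h1 := hG.ncard_eq _ hf
  rw [← Set.image_univ] at h1
  have h2 : Set.InjOn (fun a => (f a : β)) Set.univ := by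
    refine Set.injOn_of_ncard_image_eq ?_
    rw [h1, Set.ncard_univ, Nat.card_eq_fintype_card, Fintype.card_fin]
  exact fun a b hab => h2 (Set.mem_univ a) (Set.mem_univ b) (congrArg Subtype.val hab)

theorem IsUniform.colorable_of_colorableOn {β : Type v} {G : Hypergraph β} {r K : ℕ}
    (hG : G.IsUniform r) (h : ColorableOn (G.edgeTuples r) Set.univ K) : G.Colorable K := by
  obtain ⟨c, hc⟩ := h
  refine ⟨c, fun e he => ?_⟩
  have heV := G.subset_vertexSet_of_mem_edgeSet he
  obtain ⟨f, hf⟩ := exists_range_eq heV (hG.finite_vertexSet.subset heV) (hG.ncard_eq e he)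
  obtain ⟨a, b, hab⟩ := hc f (by rw [edgeTuples, Set.mem_ofPred_eq, hf]; exact he)
    fun _ => Set.mem_univ _
  exact ⟨f a, f b, hf ▸ ⟨a, rfl⟩, hf ▸ ⟨b, rfl⟩, hab⟩

theorem IsUniform.colorable_of_ncard_le {β : Type v} {G : Hypergraph β} {r K : ℕ} (hr : 2 ≤ r)
    (hG : G.IsUniform r) (h : V(G).ncard ≤ K) : G.Colorable K := by
  have := hG.finite_vertexSet.to_subtype
  let φ : V(G) ≃ Fin V(G).ncard := Finite.equivFinOfCardEq rfl
  refine ⟨fun x => Fin.castLE h (φ x), fun e he => ?_⟩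
  have heV := G.subset_vertexSet_of_mem_edgeSet he
  obtain ⟨x, hx, y, hy, hxy⟩ := (Set.one_lt_ncard (hG.finite_vertexSet.subset heV)).1
    (by rw [hG.ncard_eq e he]; omega)
  exact ⟨⟨x, heV hx⟩, ⟨y, heV hy⟩, hx, hy, fun h' => hxy
    (congrArg Subtype.val (φ.injective (Fin.castLE_injective h h')))⟩

theorem Colorable.mono {β : Type v} {G : Hypergraph β} {k l : ℕ} (h : G.Colorable k)
    (hkl : k ≤ l) : G.Colorable l := by
  obtain ⟨c, hc⟩ := h
  refine ⟨fun x => Fin.castLE hkl (c x), fun e he => ?_⟩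
  obtain ⟨x, y, hx, hy, hxy⟩ := hc e he
  exact ⟨x, y, hx, hy, fun h => hxy (Fin.castLE_injective hkl h)⟩

open Classical in
/-- The ordered link of `x`. -/
noncomputable def link {β : Type v} (G : Hypergraph β) [Fintype V(G)] (k : ℕ) (x : V(G)) :
    Finset (Fin k → V(G)) :=
  univ.filter fun w => insert (x : β) (Set.range fun j => (w j : β)) ∈ E(G)

theorem IsUniform.degree_le_card_link {β : Type v} {G : Hypergraph β} [Fintype V(G)] {k : ℕ}
    (hG : G.IsUniform (k + 1)) (x : V(G)) : G.degree x ≤ (G.link k x).card := by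
  have hsub : {e | e ∈ E(G) ∧ (x : β) ∈ e} ⊆
      (fun w : Fin k → V(G) => insert (x : β) (Set.range fun j => (w j : β))) '' G.link k x := by
    rintro e ⟨he, hx⟩
    have heV := G.subset_vertexSet_of_mem_edgeSet he
    have hfin := hG.finite_vertexSet.subset heV
    obtain ⟨w, hw⟩ := exists_range_eq (n := k) (Set.sdiff_subset.trans heV : e \ {(x : β)} ⊆ V(G))
      (hfin.subset Set.sdiff_subset)
      (by rw [Set.ncard_sdiff_singleton_of_mem hx, hG.ncard_eq e he, Nat.add_sub_cancel])
    have hins : insert (x : β) (Set.range fun j => (w j : β)) = e := by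
      rw [hw, Set.insert_sdiff_self_of_mem hx]
    exact ⟨w, by simp [link, hins, he], hins⟩
  calc G.degree x ≤ _ := Set.ncard_le_ncard hsub ((Finset.finite_toSet _).image _)
    _ ≤ (G.link k x : Set (Fin k → V(G))).ncard := Set.ncard_image_le (Finset.finite_toSet _)
    _ = _ := Set.ncard_coe_finset _

/-- For `n ≥ 2 * k` one has `n.choose k ≥ (n / 2) ^ k / k.factorial`, which accounts for the
constant. Counting one ordering per edge is enough. -/
theorem IsUniform.le_card_link {β : Type v} {G : Hypergraph β} [Fintype V(G)] {k : ℕ}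
    (hG : G.IsUniform (k + 1)) {ε : ℝ} (hε : 0 ≤ ε)
    (hdeg : ε * (V(G).ncard.choose k : ℝ) ≤ G.minDegree) (hn : 2 * k ≤ V(G).ncard) (x : V(G)) :
    ε / (2 ^ k * k.factorial) * Fintype.card (Fin k → V(G)) ≤ (G.link k x).card := by
  have h1 : G.minDegree ≤ (G.link k x).card :=
    (Nat.sInf_le (Set.mem_image_of_mem _ x.2)).trans (hG.degree_le_card_link x)
  have h1' : (G.minDegree : ℝ) ≤ (G.link k x).card := by exact_mod_cast h1
  have hcard : Fintype.card V(G) = V(G).ncard := by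
    rw [← Nat.card_eq_fintype_card]
    rfl
  set n := V(G).ncard
  have h2 : ((n + 1 - k : ℕ) ^ k : ℝ) / k.factorial ≤ n.choose k := Nat.pow_le_choose k n
  have h3 : (n : ℝ) / 2 ≤ (n + 1 - k : ℕ) := by
    have : n ≤ 2 * (n + 1 - k) := by omega
    have : (n : ℝ) ≤ 2 * (n + 1 - k : ℕ) := by exact_mod_cast this
    linarith
  have h4 : ((n : ℝ) / 2) ^ k ≤ ((n + 1 - k : ℕ) : ℝ) ^ k := by gcongr
  rw [Fintype.card_fun, Fintype.card_fin, hcard]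
  calc ε / (2 ^ k * k.factorial) * ((n ^ k : ℕ) : ℝ) = ε * (((n : ℝ) / 2) ^ k / k.factorial) := by
        push_cast
        rw [div_pow]
        field_simp
    _ ≤ ε * (((n + 1 - k : ℕ) : ℝ) ^ k / k.factorial) := by gcongr
    _ ≤ ε * n.choose k := by gcongr
    _ ≤ _ := hdeg.trans h1'

/-- The hypergraphs of positive minimum degree density that do not contain a hypergraph with a
matching encoding have bounded chromatic number. -/
theorem MatchingEncoding.exists_colorable {α : Type u} {H : Hypergraph α} (hH : V(H).Finite)
    {k m : ℕ} (hk : 1 ≤ k) {inst : NeZero (k + 1)} (enc : H.MatchingEncoding (k + 1) m)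
    {ε : ℝ} (hε : 0 < ε) :
    ∃ K : ℕ, ∀ (β : Type v) (G : Hypergraph β), G.IsUniform (k + 1) → ¬ H.IsSubhypergraph G →
      ε * (V(G).ncard.choose k : ℝ) ≤ G.minDegree → G.Colorable K := by
  classical
  have : Nontrivial (Fin (k + 1)) := Fin.nontrivial_iff_two_le.2 (by omega)
  obtain ⟨γ, hγ, K, hK⟩ := exists_edges_shattered.{v} (ι := Fin (k + 1))
    (by positivity : 0 < ε / (2 ^ k * k.factorial)) m
  obtain ⟨n₀, hn₀⟩ := exists_complete_partite_family.{v} (Fin m → Fin (k + 1)) V(H).ncard k hγ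
    (m * (k + 1))
  -- Hypergraphs with too few vertices for the density arguments are coloured injectively.
  refine ⟨max K (max n₀ (2 * k)), fun β G hG hfree hdeg => ?_⟩
  by_contra hcol
  have hn : max n₀ (2 * k) ≤ V(G).ncard := by
    by_contra! h
    exact hcol (hG.colorable_of_ncard_le (by omega) (h.le.trans (le_max_right _ _)))
  have := hG.finite_vertexSet.fintype
  have hcard : Fintype.card V(G) = V(G).ncard := by
    rw [← Nat.card_eq_fintype_card]
    rfl
  obtain ⟨e, he, he_inj, hdense⟩ := hK (G.edgeTuples (k + 1)) (G.link k)
    (fun f hf => hG.injective_of_mem_edgeTuples hf)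
    (hG.le_card_link hε.le hdeg ((le_max_right _ _).trans hn))
    (fun h => hcol ((hG.colorable_of_colorableOn h).mono (le_max_left _ _)))
  simp only [Fintype.card_fun, Fintype.card_fin, Nat.cast_pow] at hdense
  obtain ⟨g, hg_inj, hge, hg⟩ := hn₀ (hcard ▸ (le_max_left _ _).trans hn) _ hdense
    (univ.image fun p : Fin m × Fin (k + 1) => e p.1 p.2)
    (card_image_le.trans (by simp))
  have := hH.to_subtype
  let φ : V(H) ≃ Fin V(H).ncard := Finite.equivFinOfCardEq rfl
  refine hfree (enc.isSubhypergraph φ φ.injective (fun i a => e i a) he ?_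
    (fun ψ j s => g ψ j s) (fun ψ j s => (g ψ j s).2) ?_ ?_ ?_)
  · exact fun i a j b h => he_inj i a j b (Subtype.ext h)
  · exact fun ψ i s ψ' j s' h => hg_inj _ _ _ _ _ _ (Subtype.ext h)
  · exact fun ψ j s i a h =>
      hge ψ j s (mem_image.2 ⟨(i, a), mem_univ _, (Subtype.ext h).symm⟩)
  · intro ψ τ i
    exact (mem_filter.1 ((mem_filter.1 (hg ψ τ)).2 i)).2

end Hypergraph

theorem mainTheorem1 {α : Type u} (r : ℕ) [NeZero r] (hr : 2 ≤ r)
    (H : Hypergraph α) (hH : H.IsUniform r)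
    (P : Fin r → Set α) (hP : H.IsNearPartition P)
    (hext : ∀ D : Hypergraph α, (H.induce (P 0)).IsComponent D →
      H.PartiteExtendible r V(D) (⋃ (i : Fin r) (_ : i ≠ 0), P i)) :
    Hypergraph.chromaticThreshold r (Hypergraph.freeFamily.{u, v} r H) = 0 := by
  obtain ⟨m, ⟨enc⟩⟩ := hP.exists_matchingEncoding hr hH hext
  obtain ⟨k, rfl⟩ : ∃ k, r = k + 1 := ⟨r - 1, by omega⟩
  refine le_antisymm (le_of_forall_pos_le_add fun ε hε => ?_) (Real.sInf_nonneg fun c hc => hc.1)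
  rw [zero_add]
  refine csInf_le ⟨0, fun _ hc => hc.1⟩ ⟨hε.le, ?_⟩
  obtain ⟨K, hK⟩ := enc.exists_colorable hH.finite_vertexSet (by omega) hε
  exact ⟨K, fun β G hG hdeg => iInf₂_le K (hK β G hG.1 hG.2 hdeg)⟩
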